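/- Let $(R,\mathfrak m)$ be a commutative Noetherian local ring of Krull dimension one with infinite residue field. Then there is an integer $r = r(R)\ge 1$, depending only on $R$, such that every $\mathfrak m$-primary ideal $I$ of $R$ contains an element $y$ with $I^n = yI^{n-1}$ for all $n \ge r$. If moreover $R$ is Cohen–Macaulay (that is, $\operatorname{depth} R = \dim R$), then one can take $r$ to be the multiplicity $e$ of $R$, that is, the positive integer $e=\lim_{n\to\infty} \ell_R(R/\mathfrak m^n)/n$, where $\ell_R$ denotes length. -/

import Mathlib

open Filter Topology IsLocalRing

/-- The ideal `I` of the local ring `R` is primary to the maximal ideal. -/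
def IsMaximalPrimary (R : Type*) [CommRing R] [IsLocalRing R] (I : Ideal R) : Prop :=
  I.IsPrimary ∧ I.radical = maximalIdeal R

/-- The depth of a local ring: the supremum of the lengths of the `R`-regular sequences
contained in the maximal ideal. -/
noncomputable def localDepth (R : Type*) [CommRing R] [IsLocalRing R] : ℕ∞ :=
  ⨆ rs : {rs : List R // (∀ x ∈ rs, x ∈ maximalIdeal R) ∧ RingTheory.Sequence.IsRegular R rs},
    (rs.1.length : ℕ∞)

/-- A (Noetherian) local ring is Cohen-Macaulay if its depth equals its Krull dimension. -/
def IsCohenMacaulayLocal (R : Type*) [CommRing R] [IsLocalRing R] : Prop :=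
  (localDepth R : WithBot ℕ∞) = ringKrullDim R

/-- `e` is the (Hilbert-Samuel) multiplicity of the Noetherian local ring `R`: with `d` the
dimension of `R`, the sequence `d! * length (R / m ^ n) / n ^ d` tends to `e`.
(The length of `R / m ^ n` is finite since `R` is Noetherian.) -/
def IsLocalMultiplicity (R : Type*) [CommRing R] [IsLocalRing R] (e : ℕ) : Prop :=
  ∃ d : ℕ, ringKrullDim R = d ∧
    Tendsto (fun n : ℕ => (d.factorial : ℝ) *
      ((Module.length R (R ⧸ (maximalIdeal R ^ n))).toNat : ℝ) / (n : ℝ) ^ d) atTop (𝓝 (e : ℝ))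

/-- Every ideal `I` primary to the maximal ideal contains an element `y` such that
`I ^ n = y I ^ (n - 1)` for all `n ≥ r`. (Used only for `r ≥ 1`.) -/
def IsUniformReductionBound (R : Type*) [CommRing R] [IsLocalRing R] (r : ℕ) : Prop :=
  ∀ I : Ideal R, IsMaximalPrimary R I →
    ∃ y ∈ I, ∀ n : ℕ, r ≤ n → I ^ n = Ideal.span {y} * I ^ (n - 1)

/-! Choose `w` in 𝔪 with some 𝔪ᴺ ⊆ (w), and let r = ℓ(R/(w)). For every 𝔪-primary I, the space
Iʳ/𝔪Iʳ is a quotient of Iʳ/wIʳ, so its dimension is at most r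
(`Ideal.length_le_of_surjective_of_smul_eq_zero`). An Eakin–Sathaye argument in the fiber ring
(`Submodule.exists_map_mulLeft_pow_eq`), followed by Nakayama, then gives Iʳ = yIʳ⁻¹. In the
Cohen–Macaulay case, take I = 𝔪: the resulting `x` is a nonzerodivisor, so ℓ(R/𝔪ⁿ) eventually grows
by ℓ(R/(x)) at each step. Hence e = ℓ(R/(x)), and the first argument with `x` in place of `w` yields
the bound e. -/

/-! ### Eakin–Sathaye over an infinite field -/

/-- Over an infinite field, the rank of a linear map does not drop along a suitable nontrivial
perturbation in a given direction. -/
lemma LinearMap.exists_finrank_range_le_add_smul {k P N : Type*} [Field k] [Infinite k]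
    [AddCommGroup P] [Module k P] [AddCommGroup N] [Module k N] [FiniteDimensional k P]
    (f g : P →ₗ[k] N) :
    ∃ t : k, t ≠ 0 ∧ Module.finrank k (range f) ≤ Module.finrank k (range (f + t • g)) := by
  obtain ⟨φ, hφ⟩ := (range f).subtype.exists_leftInverse_of_injective (range f).ker_subtype
  obtain ⟨s, hs⟩ := f.rangeRestrict.exists_rightInverse_of_surjective f.range_rangeRestrict
  have hfs : ∀ v, f (s v) = v := fun v ↦ congrArg Subtype.val (LinearMap.congr_fun hs v)
  have hφ' : ∀ v : range f, φ v = v := fun v ↦ LinearMap.congr_fun hφ v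
  -- Compressed to `range f`, the map f + t g becomes 1 + tT, which is injective unless -t⁻¹ is an
  -- eigenvalue of `T`.
  let T : Module.End k (range f) := φ ∘ₗ g ∘ₗ s
  have hfin : Set.Finite {μ : k | T.HasEigenvalue μ} := T.finite_hasEigenvalue
  obtain ⟨c, hc⟩ := (hfin.union (Set.finite_singleton 0)).infinite_compl.nonempty
  simp only [Set.mem_compl_iff, Set.mem_union, Set.mem_ofPred_eq, Set.mem_singleton_iff,
    not_or] at hc
  refine ⟨-c⁻¹, neg_ne_zero.mpr (inv_ne_zero hc.2), ?_⟩
  let h : range f →ₗ[k] range (f + (-c⁻¹) • g) := (f + (-c⁻¹) • g).rangeRestrict ∘ₗ s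
  refine LinearMap.finrank_le_finrank_of_injective (f := h) ?_
  rw [← LinearMap.ker_eq_bot, LinearMap.ker_eq_bot']
  intro v hv
  by_contra hv0
  apply hc.1
  have h1 : f (s v) + (-c⁻¹) • g (s v) = 0 := congrArg Subtype.val hv
  have h2 : φ (f (s v) + (-c⁻¹) • g (s v)) = 0 := by rw [h1, map_zero]
  rw [map_add, map_smul, hfs, hφ'] at h2
  refine Module.End.hasEigenvalue_of_hasEigenvector (x := v) ⟨?_, hv0⟩
  rw [Module.End.mem_eigenspace_iff]
  change φ (g (s v)) = c • v
  rw [neg_smul, add_neg_eq_zero] at h2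
  exact ((eq_inv_smul_iff₀ hc.2).mp h2).symm

namespace Submodule

variable {k A : Type*} [Field k] [CommRing A] [Algebra k A]

lemma map_mulLeft_mul_pow_le (V : Submodule k A) (g : A) {y : A} (hy : y ∈ V) (n : ℕ) :
    (V ^ n).map (LinearMap.mulLeft k (g * y)) ≤ (V ^ (n + 1)).map (LinearMap.mulLeft k g) := by
  rintro _ ⟨a, ha, rfl⟩
  exact ⟨y * a, pow_succ' V n ▸ mul_mem_mul hy ha, by simp⟩

/-- The Eakin–Sathaye theorem for a single general element: if `g * V ^ n` has dimension at most
`n`, then `g * V ^ n = g * y * V ^ (n - 1)` for some `y` in `V`. -/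
theorem exists_map_mulLeft_pow_eq [Infinite k] (V : Submodule k A) (hV : V.FG) (n : ℕ) (g : A)
    (hg : Module.finrank k ((V ^ (n + 1)).map (LinearMap.mulLeft k g)) ≤ n + 1) :
    ∃ y ∈ V, (V ^ (n + 1)).map (LinearMap.mulLeft k g) =
      (V ^ n).map (LinearMap.mulLeft k (g * y)) := by
  have hfin : ∀ m (a : A), FiniteDimensional k ((V ^ m).map (LinearMap.mulLeft k a)) :=
    fun m a ↦ Module.Finite.iff_fg.mpr ((hV.pow m).map _)
  induction n generalizing g with
  | zero =>
    by_cases h : ∀ y ∈ V, g * y = 0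
    · refine ⟨0, V.zero_mem, ?_⟩
      rw [mul_zero, LinearMap.mulLeft_zero_eq_zero, Submodule.map_zero, eq_bot_iff, zero_add, pow_one]
      rintro _ ⟨y, hy, rfl⟩
      simpa using h y hy
    · push Not at h
      obtain ⟨y, hy, hgy⟩ := h
      refine ⟨y, hy, (eq_of_le_of_finrank_le (map_mulLeft_mul_pow_le V g hy 0) ?_).symm⟩
      refine hg.trans ?_
      rw [zero_add, Nat.one_le_iff_ne_zero, ← Nat.pos_iff_ne_zero, Module.finrank_pos_iff,
        nontrivial_iff_ne_bot]
      intro h0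
      apply hgy
      rw [← mem_bot k, ← h0]
      exact ⟨1, by rw [pow_zero]; exact one_le.mp le_rfl, by simp⟩
  | succ n ih =>
    -- Choose `y` making dim gyVⁿ⁺¹ maximal. If gyVⁿ⁺¹ were proper in gVⁿ⁺², its dimension would be
    -- at most n + 1, so induction would apply to `g * y`.
    let S : Set ℕ :=
      (fun y ↦ Module.finrank k ((V ^ (n + 1)).map (LinearMap.mulLeft k (g * y)))) '' V
    have hbd : BddAbove S := by
      refine ⟨Module.finrank k ((V ^ (n + 1 + 1)).map (LinearMap.mulLeft k g)), ?_⟩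
      rintro _ ⟨y, hy, rfl⟩
      exact finrank_mono (map_mulLeft_mul_pow_le V g hy _)
    obtain ⟨y, hy, hyS⟩ := Nat.sSup_mem (Set.Nonempty.image _ ⟨0, V.zero_mem⟩) hbd
    have hmax : ∀ z ∈ V, Module.finrank k ((V ^ (n + 1)).map (LinearMap.mulLeft k (g * z))) ≤
        Module.finrank k ((V ^ (n + 1)).map (LinearMap.mulLeft k (g * y))) := by
      intro z hz
      refine le_trans (le_csSup hbd ⟨z, hz, rfl⟩) hyS.ge
    refine ⟨y, hy, ?_⟩
    have hle := map_mulLeft_mul_pow_le V g hy (n + 1)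
    by_contra hne
    have hlt := finrank_lt_finrank_of_lt (lt_of_le_of_ne hle (Ne.symm hne))
    obtain ⟨z, hz, hyz⟩ := ih (g * y) (by omega)
    -- gyuVⁿ lies in both gyVⁿ⁺¹ and guVⁿ⁺¹; the dimension bound and the maximality of `y` force all
    -- three to coincide.
    have key : ∀ u ∈ V, Module.finrank k ((V ^ (n + 1)).map (LinearMap.mulLeft k (g * y))) ≤
        Module.finrank k ((V ^ n).map (LinearMap.mulLeft k (g * y * u))) →
        (V ^ (n + 1)).map (LinearMap.mulLeft k (g * u)) =
          (V ^ (n + 1)).map (LinearMap.mulLeft k (g * y)) := by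
      intro u hu h
      have h1 := map_mulLeft_mul_pow_le V (g * y) hu n
      have h2 := map_mulLeft_mul_pow_le V (g * u) hy n
      rw [mul_right_comm] at h2
      rw [← eq_of_le_of_finrank_le h1 h, ← eq_of_le_of_finrank_le h2 ((hmax u hu).trans h)]
    have hz' := key z hz (by rw [hyz])
    apply hne
    refine le_antisymm ?_ hle
    -- Both z and z + tw satisfy `key` for a suitable t ≠ 0; subtracting puts gwVⁿ⁺¹ inside gyVⁿ⁺¹.
    have hw : ∀ w ∈ V, (V ^ (n + 1)).map (LinearMap.mulLeft k (g * w)) ≤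
        (V ^ (n + 1)).map (LinearMap.mulLeft k (g * y)) := by
      intro w hw
      have : FiniteDimensional k ↥(V ^ n) := Module.Finite.iff_fg.mpr (hV.pow n)
      obtain ⟨t, ht, hr⟩ := LinearMap.exists_finrank_range_le_add_smul
        ((LinearMap.mulLeft k (g * y * z)).domRestrict (V ^ n))
        ((LinearMap.mulLeft k (g * y * w)).domRestrict (V ^ n))
      have hadd : (LinearMap.mulLeft k (g * y * z)).domRestrict (V ^ n) +
          t • (LinearMap.mulLeft k (g * y * w)).domRestrict (V ^ n) =
          (LinearMap.mulLeft k (g * y * (z + t • w))).domRestrict (V ^ n) := by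
        ext a
        simp only [LinearMap.add_apply, LinearMap.smul_apply, LinearMap.domRestrict_apply,
          LinearMap.mulLeft_apply, mul_add, add_mul, mul_smul_comm, smul_mul_assoc]
      rw [hadd, LinearMap.range_domRestrict, LinearMap.range_domRestrict, ← hyz] at hr
      have hu := key (z + t • w) (V.add_mem hz (V.smul_mem t hw)) hr
      rintro _ ⟨a, ha, rfl⟩
      have e1 : g * (z + t • w) * a ∈ (V ^ (n + 1)).map (LinearMap.mulLeft k (g * y)) :=
        hu ▸ ⟨a, ha, rfl⟩
      have e2 : g * z * a ∈ (V ^ (n + 1)).map (LinearMap.mulLeft k (g * y)) :=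
        hz' ▸ ⟨a, ha, rfl⟩
      have e3 : g * w * a = t⁻¹ • (g * (z + t • w) * a - g * z * a) := by
        rw [mul_add, add_mul, add_sub_cancel_left, mul_smul_comm, smul_mul_assoc, smul_smul,
          inv_mul_cancel₀ ht, one_smul]
      rw [LinearMap.mulLeft_apply, e3]
      exact smul_mem _ _ (sub_mem e1 e2)
    rw [map_le_iff_le_comap, pow_succ', mul_le]
    intro w hwV a ha
    exact hw w hwV ⟨a, ha, by simp⟩

end Submodule

/-! ### Length estimates and parameters -/

namespace Submodule

variable {R M : Type*} [CommRing R] [AddCommGroup M] [Module R M]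

/-- The third isomorphism theorem for lengths. -/
lemma length_quotient_eq_add {N P : Submodule R M} (h : N ≤ P) :
    Module.length R (M ⧸ N) =
      Module.length R (P ⧸ N.submoduleOf P) + Module.length R (M ⧸ P) := by
  have hker : N.submoduleOf P = LinearMap.ker (N.mkQ ∘ₗ P.subtype) := by
    rw [LinearMap.ker_comp, ker_mkQ]; rfl
  refine Module.length_eq_add_of_exact
    ((N.submoduleOf P).liftQ (N.mkQ ∘ₗ P.subtype) hker.le) (factor h)
    (LinearMap.ker_eq_bot.mp (ker_liftQ_eq_bot _ _ _ hker.ge)) (factor_surjective h) ?_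
  rw [LinearMap.exact_iff, range_liftQ, LinearMap.range_comp, range_subtype]
  ext x
  obtain ⟨x, rfl⟩ := N.mkQ_surjective x
  rw [LinearMap.mem_ker, factor_mk, mkQ_apply, Quotient.mk_eq_zero]
  exact ⟨fun hx ↦ ⟨x, hx, rfl⟩, fun ⟨y, hy, hxy⟩ ↦ by
    have := P.sub_mem hy (h ((Quotient.eq N).mp hxy))
    simpa using this⟩

end Submodule

open scoped Pointwise in
/-- An ideal `I` with `R ⧸ I` of finite length has no quotient killed by `x` whose length
exceeds that of `R ⧸ (x)`. -/
lemma Ideal.length_le_of_surjective_of_smul_eq_zero {R M : Type*} [CommRing R] [AddCommGroup M]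
    [Module R M] {I : Ideal R} (hI : Module.length R (R ⧸ I) ≠ ⊤) (x : R) (f : I →ₗ[R] M)
    (hf : Function.Surjective f) (hx : ∀ a, x • f a = 0) :
    Module.length R M ≤ Module.length R (R ⧸ Ideal.span {x}) := by
  have hle : x • I ≤ I := Submodule.smul_le_self_of_tower x I
  have hker : (x • I).submoduleOf I ≤ LinearMap.ker f := by
    rintro ⟨a, ha⟩ hxa
    obtain ⟨b, hb, hba⟩ := hxa
    have : (⟨a, ha⟩ : I) = x • ⟨b, hb⟩ := Subtype.ext hba.symm
    rw [LinearMap.mem_ker, this, map_smul, hx]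
  have h1 : Module.length R M ≤ Module.length R (I ⧸ (x • I).submoduleOf I) :=
    Module.length_le_of_surjective (((x • I).submoduleOf I).liftQ f hker)
      fun m ↦ by
        obtain ⟨a, rfl⟩ := hf m
        exact ⟨Submodule.Quotient.mk a, rfl⟩
  have h2 := Submodule.length_quotient_eq_add hle
  -- Multiplication by `x` maps R/I onto the kernel of R/xI → R/(x); it need not be injective for
  -- this bound.
  have h3 : Module.length R (R ⧸ x • I) ≤
      Module.length R (R ⧸ I) + Module.length R (R ⧸ Ideal.span {x}) := by
    rw [Module.length_eq_add_of_exact (LinearMap.range (Ideal.mulQuot x I)).subtype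
      (Ideal.quotOfMul x I) (Submodule.subtype_injective _) (Ideal.quotOfMul_surjective I)
      (by
        rw [LinearMap.exact_iff, (LinearMap.exact_iff.mp (Ideal.exact_mulQuot_quotOfMul I)),
          Submodule.range_subtype])]
    gcongr
    exact Module.length_le_of_surjective _ (LinearMap.surjective_rangeRestrict _)
  rw [h2, add_comm] at h3
  exact h1.trans ((ENat.add_le_add_iff_left hI).mp h3)

namespace IsLocalRing

variable {R : Type*} [CommRing R] [IsLocalRing R]

lemma length_quotient_ne_top_of_pow_le [IsNoetherianRing R] {I : Ideal R} {n : ℕ}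
    (h : maximalIdeal R ^ n ≤ I) : Module.length R (R ⧸ I) ≠ ⊤ := by
  by_cases hI : I = ⊤
  · subst hI
    have : Subsingleton (R ⧸ (⊤ : Ideal R)) := Ideal.Quotient.subsingleton_iff.mpr rfl
    simp
  have hmem : maximalIdeal R ∈ I.minimalPrimes := by
    refine ⟨⟨inferInstance, le_maximalIdeal hI⟩, fun q hq _ ↦ ?_⟩
    have := hq.1
    exact Ideal.IsPrime.le_of_pow_le (h.trans hq.2)
  have := quotient_artinian_of_mem_minimalPrimes_of_isLocalRing I hmem
  rw [Module.length_eq_of_surjective (S := R) (R := R ⧸ I) Ideal.Quotient.mk_surjective]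
  exact Module.length_ne_top

/-- The converse of Krull's height theorem makes 𝔪 minimal over an ideal with one generator. -/
lemma exists_pow_le_span_singleton [IsNoetherianRing R] (hdim : ringKrullDim R = 1) :
    ∃ x ∈ maximalIdeal R, ∃ n, maximalIdeal R ^ n ≤ Ideal.span {x} := by
  obtain ⟨s, hs, hcard⟩ :=
    (maximalIdeal R).exists_finset_card_eq_height_of_isNoetherianRing
  rw [← maximalIdeal_height_eq_ringKrullDim] at hdim
  have h1 : (maximalIdeal R).height = 1 := by exact_mod_cast hdim
  rw [h1, Nat.cast_eq_one, Finset.card_eq_one] at hcard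
  obtain ⟨x, rfl⟩ := hcard
  rw [Finset.coe_singleton] at hs
  have := quotient_artinian_of_mem_minimalPrimes_of_isLocalRing _ hs
  exact ⟨x, hs.1.2 (Ideal.mem_span_singleton_self x),
    exists_maximalIdeal_pow_le_of_isArtinianRing_quotient _⟩

end IsLocalRing

/-! ### The fiber ring and principal reductions -/

namespace Ideal

variable {R : Type*} [CommRing R] [IsLocalRing R] (I : Ideal R)

/-- The fiber ring `⨁ Iⁿ / 𝔪 Iⁿ` of an ideal, as a quotient of the Rees algebra. -/
def FiberRing : Type _ :=
  reesAlgebra I ⧸ (maximalIdeal R).map (algebraMap R (reesAlgebra I))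

noncomputable instance : CommRing I.FiberRing :=
  inferInstanceAs (CommRing (reesAlgebra I ⧸ (maximalIdeal R).map (algebraMap R (reesAlgebra I))))

noncomputable instance : Algebra R I.FiberRing :=
  inferInstanceAs (Algebra R (reesAlgebra I ⧸ (maximalIdeal R).map (algebraMap R (reesAlgebra I))))

noncomputable instance : Algebra (IsLocalRing.ResidueField R) I.FiberRing :=
  inferInstanceAs (Algebra (R ⧸ maximalIdeal R)
    (reesAlgebra I ⧸ (maximalIdeal R).map (algebraMap R (reesAlgebra I))))

instance : IsScalarTower R (IsLocalRing.ResidueField R) I.FiberRing :=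
  .of_algebraMap_eq fun _ ↦ rfl

/-- The degree `n` part of the fiber ring. -/
noncomputable def toFiberRing (n : ℕ) : ↥(I ^ n) →ₗ[R] I.FiberRing :=
  (Ideal.Quotient.mkₐ R _).toLinearMap ∘ₗ
    ((Polynomial.monomial n).domRestrict (I ^ n)).codRestrict (Subalgebra.toSubmodule (reesAlgebra I))
      fun a ↦ reesAlgebra.monomial_mem.mpr a.2

lemma toFiberRing_mul {m n : ℕ} (a : ↥(I ^ m)) (b : ↥(I ^ n)) :
    I.toFiberRing m a * I.toFiberRing n b =
      I.toFiberRing (m + n) ⟨a * b, pow_add I m n ▸ mul_mem_mul a.2 b.2⟩ := by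
  refine (map_mul (Ideal.Quotient.mk _) _ _).symm.trans (congrArg (Ideal.Quotient.mk _) ?_)
  exact Subtype.ext (Polynomial.monomial_mul_monomial _ _ _ _)

lemma smul_toFiberRing {n : ℕ} {x : R} (hx : x ∈ maximalIdeal R) (a : ↥(I ^ n)) :
    x • I.toFiberRing n a = 0 := by
  have : algebraMap R I.FiberRing x = 0 :=
    Ideal.Quotient.eq_zero_iff_mem.mpr (mem_map_of_mem _ hx)
  rw [Algebra.smul_def, this, zero_mul]

/-- Elements of the extension of 𝔪 to the Rees algebra have n-th coefficient in 𝔪Iⁿ. -/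
lemma mem_smul_pow_of_toFiberRing_eq_zero {n : ℕ} {a : ↥(I ^ n)} (h : I.toFiberRing n a = 0) :
    (a : R) ∈ maximalIdeal R * I ^ n := by
  have key : ∀ f ∈ (maximalIdeal R).map (algebraMap R (reesAlgebra I)),
      ∀ n, (f : Polynomial R).coeff n ∈ maximalIdeal R * I ^ n := by
    intro f hf
    rw [map] at hf
    induction hf using Submodule.span_induction with
    | mem f hf =>
      obtain ⟨c, hc, rfl⟩ := hf
      intro n
      change (Polynomial.C c).coeff n ∈ _
      rw [Polynomial.coeff_C]
      split_ifs with hn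
      · subst hn
        simpa using hc
      · exact zero_mem _
    | zero => simp
    | add f g _ _ hf hg => exact fun n ↦ by simpa using add_mem (hf n) (hg n)
    | smul f g _ hg =>
      intro n
      change ((f : Polynomial R) * (g : Polynomial R)).coeff n ∈ _
      rw [Polynomial.coeff_mul]
      refine Submodule.sum_mem _ fun p hp ↦ ?_
      rw [← Finset.HasAntidiagonal.mem_antidiagonal.mp hp, pow_add, mul_left_comm]
      exact mul_mem_mul (f.2 _) (hg _)
  have := key _ (Ideal.Quotient.eq_zero_iff_mem.mp h) n
  change (Polynomial.monomial n (a : R)).coeff n ∈ _ at this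
  rwa [Polynomial.coeff_monomial_same] at this

/-- The degree `n` part of the fiber ring, as a vector space over the residue field. -/
noncomputable def fiberRingDegree (n : ℕ) : Submodule (IsLocalRing.ResidueField R) I.FiberRing where
  __ := (LinearMap.range (I.toFiberRing n)).toAddSubmonoid
  smul_mem' c x hx := by
    obtain ⟨c, rfl⟩ := residue_surjective c
    have : residue R c • x = c • x := algebraMap_smul (IsLocalRing.ResidueField R) c x
    rw [this]
    exact (LinearMap.range (I.toFiberRing n)).smul_mem c hx

lemma mem_fiberRingDegree {n : ℕ} {x : I.FiberRing} :
    x ∈ I.fiberRingDegree n ↔ ∃ a, I.toFiberRing n a = x := Iff.rfl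

/-- The fiber ring is generated in degree one, so Eakin–Sathaye for the degree-one part speaks of
the powers of I. -/
lemma fiberRingDegree_one_pow (n : ℕ) : I.fiberRingDegree 1 ^ n = I.fiberRingDegree n := by
  induction n with
  | zero =>
    rw [pow_zero]
    ext x
    rw [Submodule.mem_one, mem_fiberRingDegree, residue_surjective.exists]
    constructor
    · rintro ⟨y, rfl⟩
      exact ⟨⟨y, by simp⟩, rfl⟩
    · rintro ⟨a, rfl⟩
      exact ⟨a, rfl⟩
  | succ n ih =>
    rw [pow_succ, ih]
    apply le_antisymm
    · rw [Submodule.mul_le]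
      rintro _ ⟨a, rfl⟩ _ ⟨b, rfl⟩
      exact ⟨_, (I.toFiberRing_mul a b).symm⟩
    · suffices ∀ a ∈ I ^ n * I, ∀ ha : a ∈ I ^ (n + 1),
          I.toFiberRing (n + 1) ⟨a, ha⟩ ∈ I.fiberRingDegree n * I.fiberRingDegree 1 by
        rintro _ ⟨⟨a, ha⟩, rfl⟩
        exact this a (pow_succ I n ▸ ha) ha
      intro a ha
      induction ha using Submodule.mul_induction_on' with
      | mem_mul_mem a ha b hb =>
        intro _
        have := I.toFiberRing_mul ⟨a, ha⟩ (⟨b, by rwa [pow_one]⟩ : ↥(I ^ 1))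
        exact this ▸ Submodule.mul_mem_mul ⟨_, rfl⟩ ⟨_, rfl⟩
      | add a ha b hb h1 h2 =>
        intro _
        have := Submodule.add_mem _ (h1 (pow_succ I n ▸ ha)) (h2 (pow_succ I n ▸ hb))
        rwa [← map_add] at this

end Ideal

namespace Ideal

variable {R : Type*} [CommRing R] [IsLocalRing R] (I : Ideal R)

lemma length_fiberRingDegree (n : ℕ) :
    Module.length (IsLocalRing.ResidueField R) (I.fiberRingDegree n) =
      Module.length R (LinearMap.range (I.toFiberRing n)) := by
  have h := Module.length_eq_of_surjective (S := R) (R := IsLocalRing.ResidueField R)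
    (M := I.fiberRingDegree n) residue_surjective
  exact h.symm

lemma finrank_fiberRingDegree_le {n : ℕ} (hI : Module.length R (R ⧸ I ^ n) ≠ ⊤) {x : R}
    (hx : x ∈ maximalIdeal R) :
    (Module.finrank (IsLocalRing.ResidueField R) (I.fiberRingDegree n) : ℕ∞) ≤
      Module.length R (R ⧸ Ideal.span {x}) := by
  refine le_trans ?_ (length_le_of_surjective_of_smul_eq_zero hI x
    (I.toFiberRing n).rangeRestrict (LinearMap.surjective_rangeRestrict _)
    fun a ↦ Subtype.ext (I.smul_toFiberRing hx a))
  rw [← length_fiberRingDegree]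
  by_cases h : Module.Finite (IsLocalRing.ResidueField R) (I.fiberRingDegree n)
  · rw [Module.length_eq_finrank]
  · rw [Module.finrank_of_not_finite h]
    exact zero_le

lemma fiberRingDegree_fg [IsNoetherianRing R] (n : ℕ) : (I.fiberRingDegree n).FG := by
  have h : Module.Finite R (I.fiberRingDegree n) :=
    inferInstanceAs (Module.Finite R (LinearMap.range (I.toFiberRing n)))
  exact Module.Finite.iff_fg.mp (Module.Finite.of_restrictScalars_finite R _ _)

/-- If `I ^ (n + 1)` is generated by at most `n + 1` elements, then `I` has a principal
reduction with reduction number at most `n`. -/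
lemma exists_pow_succ_eq_span_mul_pow [IsNoetherianRing R] [Infinite (IsLocalRing.ResidueField R)]
    {n : ℕ} (h : Module.finrank (IsLocalRing.ResidueField R) (I.fiberRingDegree (n + 1)) ≤ n + 1) :
    ∃ y ∈ I, I ^ (n + 1) = Ideal.span {y} * I ^ n := by
  have hone : ∀ V : Submodule (IsLocalRing.ResidueField R) I.FiberRing,
      V.map (LinearMap.mulLeft (IsLocalRing.ResidueField R) 1) = V := fun V ↦ by
    ext a
    simp
  obtain ⟨_, ⟨⟨y, hy⟩, rfl⟩, heq⟩ := Submodule.exists_map_mulLeft_pow_eq (I.fiberRingDegree 1)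
    (I.fiberRingDegree_fg 1) n 1
    (by rwa [hone, fiberRingDegree_one_pow])
  rw [hone, fiberRingDegree_one_pow, fiberRingDegree_one_pow] at heq
  have hyI : y ∈ I := by rwa [pow_one] at hy
  refine ⟨y, hyI, le_antisymm ?_ ?_⟩
  -- Nakayama: it suffices that Iⁿ⁺¹ ⊆ yIⁿ + 𝔪Iⁿ⁺¹.
  · refine Submodule.le_of_le_smul_of_le_jacobson_bot (I := maximalIdeal R)
      (IsNoetherian.noetherian _) (maximalIdeal_le_jacobson _) ?_
    intro a ha
    have hmem : I.toFiberRing (n + 1) ⟨a, ha⟩ ∈ I.fiberRingDegree (n + 1) := ⟨_, rfl⟩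
    rw [heq] at hmem
    obtain ⟨_, ⟨b, rfl⟩, hb⟩ := hmem
    have hyb : y * b ∈ I ^ (n + 1) := pow_succ' I n ▸ mul_mem_mul hyI b.2
    have hsub : I.toFiberRing (n + 1) (⟨a, ha⟩ - ⟨y * b, hyb⟩) = 0 := by
      rw [map_sub, ← hb, LinearMap.mulLeft_apply, one_mul, toFiberRing_mul, sub_eq_zero]
      have : ∀ m (hm : m = n + 1) (h' : y * b ∈ I ^ m),
          I.toFiberRing m ⟨y * b, h'⟩ = I.toFiberRing (n + 1) ⟨y * b, hyb⟩ := by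
        rintro _ rfl _; rfl
      exact this _ (add_comm 1 n) _
    have hm := I.mem_smul_pow_of_toFiberRing_eq_zero hsub
    rw [← add_sub_cancel (y * b : R) a]
    exact Submodule.add_mem_sup (mul_mem_mul (mem_span_singleton_self y) b.2) hm
  · rw [pow_succ']
    exact mul_mono_left ((span_singleton_le_iff_mem _).mpr hyI)

end Ideal

/-! ### Uniform bound and multiplicity -/

namespace IsLocalRing

variable {R : Type*} [CommRing R] [IsLocalRing R]

lemma _root_.IsMaximalPrimary.exists_pow_le [IsNoetherianRing R] {I : Ideal R}
    (hI : IsMaximalPrimary R I) : ∃ n, maximalIdeal R ^ n ≤ I := by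
  rw [← hI.2]
  exact I.exists_radical_pow_le_of_fg (IsNoetherian.noetherian _)

lemma isMaximalPrimary_maximalIdeal : IsMaximalPrimary R (maximalIdeal R) :=
  ⟨Ideal.IsPrime.isPrimary inferInstance, Ideal.IsPrime.radical inferInstance⟩

lemma isUniformReductionBound_length [IsNoetherianRing R] [Infinite (ResidueField R)] {x : R}
    (hx : x ∈ maximalIdeal R) {N : ℕ} (hN : maximalIdeal R ^ N ≤ Ideal.span {x}) :
    1 ≤ (Module.length R (R ⧸ Ideal.span {x})).toNat ∧
      IsUniformReductionBound R (Module.length R (R ⧸ Ideal.span {x})).toNat := by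
  have htop := length_quotient_ne_top_of_pow_le hN
  have hnt : Nontrivial (R ⧸ Ideal.span {x}) := Ideal.Quotient.nontrivial_iff.mpr fun h ↦
    (maximalIdeal.isMaximal R).ne_top (top_le_iff.mp
      (h ▸ (Ideal.span_singleton_le_iff_mem _).mpr hx))
  generalize hr : (Module.length R (R ⧸ Ideal.span {x})).toNat = r
  have hlen : Module.length R (R ⧸ Ideal.span {x}) = r := by rw [← hr, ENat.natCast_toNat htop]
  have hpos : 1 ≤ r := by
    have := Module.length_pos (R := R) (M := R ⧸ Ideal.span {x})
    rw [hlen] at this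
    exact_mod_cast this
  refine ⟨hpos, fun I hI ↦ ?_⟩
  obtain ⟨M, hM⟩ := hI.exists_pow_le
  obtain ⟨s, rfl⟩ : ∃ s, r = s + 1 := ⟨r - 1, by omega⟩
  have hfin : Module.length R (R ⧸ I ^ (s + 1)) ≠ ⊤ :=
    length_quotient_ne_top_of_pow_le (n := M * (s + 1))
      (by rw [pow_mul]; exact Ideal.pow_right_mono hM _)
  have hle := I.finrank_fiberRingDegree_le hfin hx
  rw [hlen] at hle
  obtain ⟨y, hy, heq⟩ := I.exists_pow_succ_eq_span_mul_pow (Nat.cast_le.mp hle)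
  refine ⟨y, hy, fun n hn ↦ ?_⟩
  obtain ⟨d, rfl⟩ := Nat.exists_eq_add_of_le hn
  rw [pow_add, heq, mul_assoc, ← pow_add]
  congr 2
  omega

lemma exists_mem_nonZeroDivisors_of_isCohenMacaulayLocal (hdim : ringKrullDim R = 1)
    (hCM : IsCohenMacaulayLocal R) : ∃ z ∈ maximalIdeal R, z ∈ nonZeroDivisors R := by
  rw [IsCohenMacaulayLocal, hdim] at hCM
  have h1 : localDepth R = 1 := by exact_mod_cast hCM
  by_contra! hcon
  have h0 : localDepth R = 0 := by
    refine nonpos_iff_eq_zero.mp (iSup_le ?_)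
    rintro ⟨_ | ⟨z, rs⟩, hmem, hreg⟩
    · simp
    · refine absurd ?_ (hcon z (hmem z (by simp)))
      have := ((RingTheory.Sequence.isRegular_cons_iff R z rs).mp hreg).1
      exact mem_nonZeroDivisors_iff_right.mpr fun a ha ↦ this (by simpa [mul_comm] using ha)
  simp [h0] at h1

open scoped Pointwise in
lemma length_quotient_pow_succ {x : R} (hx : x ∈ nonZeroDivisors R) {n : ℕ}
    (h : maximalIdeal R ^ (n + 1) = Ideal.span {x} * maximalIdeal R ^ n) :
    Module.length R (R ⧸ maximalIdeal R ^ (n + 1)) =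
      Module.length R (R ⧸ maximalIdeal R ^ n) + Module.length R (R ⧸ Ideal.span {x}) := by
  have hs : maximalIdeal R ^ (n + 1) = x • maximalIdeal R ^ n := by
    rw [h, ← smul_eq_mul, Submodule.ideal_span_singleton_smul]
  rw [hs]
  exact Module.length_eq_add_of_exact _ _ (Ideal.mulQuot_injective _ hx)
    (Ideal.quotOfMul_surjective _) (Ideal.exact_mulQuot_quotOfMul _)

lemma isLocalMultiplicity_length [IsNoetherianRing R] (hdim : ringKrullDim R = 1) {x : R}
    (hx : x ∈ nonZeroDivisors R) {N : ℕ}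
    (h : ∀ n, N ≤ n → maximalIdeal R ^ (n + 1) = Ideal.span {x} * maximalIdeal R ^ n) :
    IsLocalMultiplicity R (Module.length R (R ⧸ Ideal.span {x})).toNat := by
  have hfin : ∀ n, Module.length R (R ⧸ maximalIdeal R ^ n) ≠ ⊤ :=
    fun n ↦ length_quotient_ne_top_of_pow_le le_rfl
  have htop : Module.length R (R ⧸ Ideal.span {x}) ≠ ⊤ :=
    length_quotient_ne_top_of_pow_le ((h N le_rfl).trans_le Ideal.mul_le_left)
  set e := (Module.length R (R ⧸ Ideal.span {x})).toNat
  refine ⟨1, by simpa using hdim, ?_⟩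
  have hlin : ∀ d, (Module.length R (R ⧸ maximalIdeal R ^ (N + d))).toNat =
      (Module.length R (R ⧸ maximalIdeal R ^ N)).toNat + d * e := by
    intro d
    induction d with
    | zero => simp
    | succ d ih =>
      rw [← add_assoc, length_quotient_pow_succ hx (h (N + d) (Nat.le_add_right _ _)),
        ENat.toNat_add (hfin _) htop, ih]
      ring
  set c := (Module.length R (R ⧸ maximalIdeal R ^ N)).toNat
  have hlim : Tendsto (fun n : ℕ ↦ (e : ℝ) + ((c : ℝ) - N * e) / n) atTop (𝓝 e) := by
    simpa using tendsto_const_nhds.add (tendsto_const_div_atTop_nhds_zero_nat ((c : ℝ) - N * e))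
  refine hlim.congr' ?_
  filter_upwards [eventually_ge_atTop N, eventually_gt_atTop 0] with n hn hn0
  obtain ⟨d, rfl⟩ := Nat.exists_eq_add_of_le hn
  have : ((N + d : ℕ) : ℝ) ≠ 0 := by positivity
  rw [hlin, Nat.factorial_one, pow_one]
  field_simp
  push_cast
  ring

end IsLocalRing

theorem mainTheorem2 (R : Type*) [CommRing R] [IsLocalRing R] [IsNoetherianRing R]
    (hdim : ringKrullDim R = 1) (hres : Infinite (ResidueField R)) :
    (∃ r : ℕ, 1 ≤ r ∧ IsUniformReductionBound R r) ∧
      (IsCohenMacaulayLocal R →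
        ∃ e : ℕ, 1 ≤ e ∧ IsLocalMultiplicity R e ∧ IsUniformReductionBound R e) := by
  obtain ⟨w, hw, N, hN⟩ := exists_pow_le_span_singleton hdim
  obtain ⟨hr, hbound⟩ := isUniformReductionBound_length hw hN
  refine ⟨⟨_, hr, hbound⟩, fun hCM ↦ ?_⟩
  obtain ⟨x, hx, hpow⟩ := hbound _ isMaximalPrimary_maximalIdeal
  generalize (Module.length R (R ⧸ Ideal.span {w})).toNat = r at hr hpow
  have hle : maximalIdeal R ^ r ≤ Ideal.span {x} :=
    (hpow r le_rfl).trans_le Ideal.mul_le_left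
  obtain ⟨z, hz, hzreg⟩ := exists_mem_nonZeroDivisors_of_isCohenMacaulayLocal hdim hCM
  -- `x` divides the nonzerodivisor zʳ, hence is one itself.
  obtain ⟨a, ha⟩ := Ideal.mem_span_singleton.mp (hle (Ideal.pow_mem_pow hz r))
  have hxreg : x ∈ nonZeroDivisors R :=
    (mul_mem_nonZeroDivisors.mp (ha ▸ pow_mem hzreg r)).1
  obtain ⟨he, hbound'⟩ := isUniformReductionBound_length hx hle
  exact ⟨_, he, isLocalMultiplicity_length hdim hxreg
    fun n hn ↦ hpow (n + 1) (hn.trans n.le_succ), hbound'⟩
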